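/- Let $H$ be a real Hilbert space with dual $H^*$ and Riesz isomorphism $\iota\colon H^*\to H$. Let $\xi$ be a random variable, and let $f(\cdot,\xi)\colon H\to\mathbb R$ be a random function that is almost surely convex, lower semicontinuous, proper and Gâteaux differentiable, where $\nabla$ is the Gâteaux derivative in the first argument; for each $u\in H$, $f(u,\xi)$ and $\nabla f(u,\xi)\in H^*$ are (strongly) measurable. Put $F(w)=\mathbb E_\xi[f(w,\xi)]$ and let $w^*\in H$ minimize $F$. Assume: 1. there is an integer $m\ge 1$ with $\sigma:=\big(\mathbb E_\xi[\|\nabla f(w^*,\xi)\|_{H^*}^{2^m}]\big)^{2^{-m}}<\infty$; 2. for every $R>0$ there is a random $L_R=L_R(\xi)\in\mathbb R$ such that almost surely $\|\nabla f(u,\xi)-\nabla f(v,\xi)\|_{H^*}\le L_R\|u-v\|$ for all $u,v\in H$ with $\|u\|,\|v\|\le R$, and there is a real polynomial $p$ of degree at most $2^m-2$ such that, for every $R>0$, $L_R\le p(R)$ almost surely; 3. there are a random bounded symmetric linear operator $M=M(\xi)$ on $H$ and a real random variable $\bar\mu=\bar\mu(\xi)\ge 0$ such that almost surely, for all $u,v\in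 H$, $$f(u,\xi)\ge f(v,\xi)+\langle\nabla f(v,\xi),u-v\rangle+\tfrac12(M(u-v),u-v)\quad\text{and}\quad (Mu,u)\ge\bar\mu\|u\|^2,$$ with $\mathbb E[\bar\mu]=\mu>0$ and $\mathbb E[\bar\mu^2]=\nu^2<\infty$; 4. $F(u)<\infty$ for some $u\in H$, and $\mathbb E_\xi[\inf_{u\in H}f(u,\xi)]>-\infty$. Let $\xi^1,\xi^2,\dots$ be jointly independent random variables on a probability space, each distributed as $\xi$; let $\eta>1/\mu$, $\alpha_k=\eta/k$ and $w_1\in H$. Let $(w^k)_{k\ge1}$ be $H$-valued and satisfy, almost surely, $$w^1=w_1,\qquad w^{k+1}=w^k-\alpha_k\,\iota\nabla f(w^{k+1},\xi^k),\quad k\ge 1.$$ Then, for every $k\ge1$, $w^k$ is almost everywhere equal to a strongly measurable function, $\|w^k-w^*\|^2$ is integrable, and $$\mathbb E\big[\|w^k-w^*\|^2\big]\le\frac Ck,$$ where $C$ depends only on $\|w_1-w^*\|$, $\mu$, $\nu$, $\sigma$, $\eta$ and $m$. -/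

import Mathlib

open MeasureTheory ProbabilityTheory

universe u v w

/-- `L` is the Gâteaux derivative of `g : H → ℝ` at `x`: a bounded linear functional that gives all
directional derivatives of `g` at `x`. -/
def HasGateauxDerivAt {H : Type u} [NormedAddCommGroup H] [InnerProductSpace ℝ H]
    (g : H → ℝ) (L : StrongDual ℝ H) (x : H) : Prop :=
  ∀ h : H, HasLineDerivAt ℝ g (L h) x h

/-- A function has at most one Gâteaux derivative at a point. -/
theorem HasGateauxDerivAt.unique {H : Type u} [NormedAddCommGroup H] [InnerProductSpace ℝ H]
    {g : H → ℝ} {L₁ L₂ : StrongDual ℝ H} {x : H}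
    (h₁ : HasGateauxDerivAt g L₁ x) (h₂ : HasGateauxDerivAt g L₂ x) : L₁ = L₂ :=
  ContinuousLinearMap.ext fun h => (h₁ h).unique (h₂ h)

open Classical in
/-- The Gâteaux derivative `∇g(x) ∈ H*` (the zero functional where `g` is not Gâteaux
differentiable). -/
noncomputable def gateauxDeriv {H : Type u} [NormedAddCommGroup H] [InnerProductSpace ℝ H]
    (g : H → ℝ) (x : H) : StrongDual ℝ H :=
  if h : ∃ L, HasGateauxDerivAt g L x then h.choose else 0

theorem HasGateauxDerivAt.gateauxDeriv_eq {H : Type u} [NormedAddCommGroup H]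
    [InnerProductSpace ℝ H] {g : H → ℝ} {L : StrongDual ℝ H} {x : H}
    (h : HasGateauxDerivAt g L x) : gateauxDeriv g x = L := by
  have hex : ∃ L, HasGateauxDerivAt g L x := ⟨L, h⟩
  unfold gateauxDeriv
  rw [dif_pos hex]
  exact hex.choose_spec.unique h

/-- The expectation `E[X⁺] - E[X⁻]` of an extended-real random variable (`⊥` if `E[X⁻] = ∞`). -/
noncomputable def extExpectation {Ξ : Type w} [MeasurableSpace Ξ] (ρ : Measure Ξ)
    (X : Ξ → EReal) : EReal :=
  ((∫⁻ s, (X s).toENNReal ∂ρ : ENNReal) : EReal) - ((∫⁻ s, (-X s).toENNReal ∂ρ : ENNReal) : EReal)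

/-- The objective `F(w) = E_ξ[f(w, ξ)]`, where `ρ` is the distribution of `ξ`. -/
noncomputable def objective {H : Type u} {Ξ : Type w} [MeasurableSpace Ξ] (ρ : Measure Ξ)
    (f : H → Ξ → ℝ) (x : H) : EReal :=
  extExpectation ρ fun s => (f x s : EReal)

/-- The standing assumptions on the random convex function `f(·, ξ)`, where `ρ` is the distribution
of `ξ`, so that `E_ξ` is integration against `ρ` and "almost surely" means `ρ`-almost everywhere.
The functions `f(·, s)` are real-valued, hence proper. -/
structure SPIAssumption {H : Type u} [NormedAddCommGroup H] [InnerProductSpace ℝ H]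
    {Ξ : Type w} [MeasurableSpace Ξ] (ρ : Measure Ξ) (f : H → Ξ → ℝ) (wstar : H)
    (m : ℕ) (μ ν σ : ℝ) : Prop where
  /-- `f(x, ξ)` is a real random variable for every `x` -/
  aemeasurable : ∀ x, AEMeasurable (f x) ρ
  /-- `∇f(x, ξ)` is an `H*`-valued random variable for every `x` -/
  aestronglyMeasurable_deriv :
    ∀ x, AEStronglyMeasurable (fun s => gateauxDeriv (fun y => f y s) x) ρ
  lowerSemicontinuous : ∀ᵐ s ∂ρ, LowerSemicontinuous fun x => f x s
  convex : ∀ᵐ s ∂ρ, ConvexOn ℝ Set.univ fun x => f x s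
  differentiable : ∀ᵐ s ∂ρ, ∀ x, ∃ L, HasGateauxDerivAt (fun y => f y s) L x
  one_le_m : 1 ≤ m
  /-- the `2^m`-th moment of the gradient at `w*` is finite, and `σ` is its `2^m`-th root -/
  integrable_moment : Integrable (fun s => ‖gateauxDeriv (fun y => f y s) wstar‖ ^ (2 ^ m)) ρ
  moment_eq :
    (∫ s, ‖gateauxDeriv (fun y => f y s) wstar‖ ^ (2 ^ m) ∂ρ) ^ ((1 : ℝ) / 2 ^ m) = σ
  /-- local Lipschitz continuity of the gradient; the constants `L_R` grow polynomially in `R` -/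
  lipschitz : ∃ Lip : ℝ → Ξ → ℝ,
    (∀ R > 0, ∀ᵐ s ∂ρ, ∀ x y : H, ‖x‖ ≤ R → ‖y‖ ≤ R →
      ‖gateauxDeriv (fun z => f z s) x - gateauxDeriv (fun z => f z s) y‖ ≤ Lip R s * ‖x - y‖) ∧
    ∃ p : Polynomial ℝ, p.natDegree ≤ 2 ^ m - 2 ∧ ∀ R > 0, ∀ᵐ s ∂ρ, Lip R s ≤ p.eval R
  /-- `M`-convexity with a symmetric random operator `M ≥ μ̄`, with `E[μ̄] = μ > 0` and
  `E[μ̄²] = ν² < ∞` -/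
  mconvex : ∃ (M : Ξ → H →L[ℝ] H) (mubar : Ξ → ℝ),
    (∀ᵐ s ∂ρ, (M s : H →ₗ[ℝ] H).IsSymmetric) ∧
    (∀ᵐ s ∂ρ, ∀ x y : H,
      f y s + gateauxDeriv (fun z => f z s) y (x - y) + 1 / 2 * inner ℝ (M s (x - y)) (x - y)
        ≤ f x s) ∧
    (∀ᵐ s ∂ρ, 0 ≤ mubar s) ∧
    (∀ᵐ s ∂ρ, ∀ x : H, mubar s * ‖x‖ ^ 2 ≤ inner ℝ (M s x) x) ∧
    Integrable mubar ρ ∧ ∫ s, mubar s ∂ρ = μ ∧ 0 < μ ∧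
    Integrable (fun s => mubar s ^ 2) ρ ∧ ∫ s, mubar s ^ 2 ∂ρ = ν ^ 2
  /-- `F(x) < ∞` for some `x` -/
  objective_lt_top : ∃ x, objective ρ f x < ⊤
  /-- `inf_x f(x, ξ)` is a random variable, and `E_ξ[inf_x f(x, ξ)] > -∞` -/
  aemeasurable_iInf : AEMeasurable (fun s => ⨅ x, (f x s : EReal)) ρ
  bot_lt_iInf : ⊥ < extExpectation ρ fun s => ⨅ x, (f x s : EReal)
  /-- `w*` minimizes `F` -/
  isMin : ∀ x, objective ρ f wstar ≤ objective ρ f x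

/-- `(w^k)`, `k = 1, 2, …`, follows the stochastic proximal iteration with initial value `w₁` and
step sizes `α`: almost surely, `w^1 = w₁` and `w^{k+1} = w^k - α_k ι ∇f(w^{k+1}, ξ^k)`, where
`ι : H* → H` is the Riesz isomorphism. -/
structure IsSPI {H : Type u} [NormedAddCommGroup H] [InnerProductSpace ℝ H] [CompleteSpace H]
    {Ω : Type v} [MeasurableSpace Ω] (P : Measure Ω) {Ξ : Type w} (f : H → Ξ → ℝ)
    (ξ : ℕ+ → Ω → Ξ) (α : ℕ+ → ℝ) (w₁ : H) (W : ℕ+ → Ω → H) : Prop where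
  init : ∀ᵐ ω ∂P, W 1 ω = w₁
  step : ∀ k : ℕ+, ∀ᵐ ω ∂P, W (k + 1) ω = W k ω - α k •
    (InnerProductSpace.toDual ℝ H).symm (gateauxDeriv (fun y => f y (ξ k ω)) (W (k + 1) ω))

/-!
The argument is a contraction estimate for the resolvent. Write `r = w^k - w*`, `g = ∇f(w*, ξ^k)` and
`α = α_k`. By `M`-convexity the gradient is `μ̄`-strongly monotone, so the implicit step contracts
`r - α ι g` by the factor `(1 + α μ̄)⁻¹`. Expanding the square, and splitting the cross term, whose
random weight `(1 + α μ̄)⁻²` is correlated with `g`, into its value at weight `1` and an error of order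
`α²`, one gets the pointwise inequality (`norm_sq_le_of_implicit_step`)
`‖w^{k+1} - w*‖² ≤ (1 - 2 α μ̄ + 5 α² μ̄²) ‖r‖² - 2 α g(r) + 3 α² ‖g‖²`.
Here `r` depends on `ξ^1, …, ξ^{k-1}` only, so it is independent of `ξ^k`, and `E[g] = 0` because `w*`
minimizes `F` (`SPIAssumption.integral_gateauxDeriv_eq_zero`). Hence `e_k = E‖w^k - w*‖²` satisfies
`e_{k+1} ≤ (1 - 2ημ/k + O(1/k²)) e_k + O(1/k²)`, and `2ημ > 2` yields `e_k ≤ C/k`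
(`exists_le_div_of_recursion`).

The measurability of `w^k` with respect to the past is the other half of the proof. The implicit
equation has no closed solution, but with locally Lipschitz gradients, whose Lipschitz constants are
bounded uniformly in `ξ` on each ball, its solution is the limit of an explicit iteration
(`tendsto_resolventIterate`). Each iterate is a.e. strongly measurable, since a random field that is
measurable at each point and a.s. continuous may be evaluated at a strongly measurable random point
(`aestronglyMeasurable_comp_of_ae_continuous`). No separability of `H` is needed.
-/

open Filter Topology

/-! ### A recursive inequality -/

/-- The rate `1/k` for a recursion with factor `1 - a/k + b/k²` and `a > 2`. Once `b ≤ (a - 2) k` the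
factor is at most `1 - 2/k`, and `C/k` with `C ≥ c` is a supersolution; before that, a crude
geometric bound is absorbed into `C`. -/
theorem exists_le_div_of_recursion {a b c D : ℝ} (ha : 2 < a) (hb : 0 ≤ b) (hc : 0 ≤ c)
    (hD : 0 ≤ D) :
    ∃ C : ℝ, ∀ e : ℕ+ → ℝ, (∀ k, 0 ≤ e k) → e 1 ≤ D →
      (∀ k : ℕ+, e (k + 1) ≤ (1 - a / k + b / (k : ℝ) ^ 2) * e k + c / (k : ℝ) ^ 2) →
      ∀ k : ℕ+, e k ≤ C / k := by
  obtain ⟨n, hn⟩ := exists_nat_ge (b / (a - 2))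
  set K : ℕ := max n 2
  set B : ℕ → ℝ := fun k => (1 + b + c) ^ k * (D + 1)
  refine ⟨max c (K * B K), fun e he0 he1 hrec => ?_⟩
  have hB : ∀ k : ℕ+, e k ≤ B k := by
    intro k
    induction k using PNat.recOn with
    | one =>
      simp only [B, PNat.one_coe, pow_one]
      nlinarith
    | succ k ih =>
      have hk : (1 : ℝ) ≤ k := by exact_mod_cast k.pos
      have hk2 : (1 : ℝ) ≤ (k : ℝ) ^ 2 := one_le_pow₀ hk
      have h1 : 1 - a / k + b / (k : ℝ) ^ 2 ≤ 1 + b := by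
        have := div_le_self hb hk2
        have : 0 ≤ a / k := by positivity
        linarith
      have h2 := div_le_self hc hk2
      have h3 := mul_le_mul_of_nonneg_right h1 (he0 k)
      have h4 : (1 : ℝ) ≤ B k := by
        have : (1 : ℝ) ≤ (1 + b + c) ^ (k : ℕ) := one_le_pow₀ (by linarith)
        simp only [B]
        nlinarith
      have h5 : B (k + 1 : ℕ+) = (1 + b + c) * B k := by
        simp only [B, PNat.add_coe, PNat.one_coe, pow_succ]
        ring
      rw [h5]
      nlinarith [hrec k]
  have hBmono : Monotone B := by
    intro i j hij
    exact mul_le_mul_of_nonneg_right (pow_le_pow_right₀ (by linarith) hij) (by linarith)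
  have hB0 : ∀ k, 0 ≤ B k := fun k => by positivity
  intro k
  induction k using PNat.recOn with
  | one =>
    rw [PNat.one_coe, Nat.cast_one, div_one]
    refine (hB 1).trans ((hBmono (show ((1 : ℕ+) : ℕ) ≤ K by simp [K])).trans
      (le_trans ?_ (le_max_right _ _)))
    have : (1 : ℝ) ≤ K := by exact_mod_cast (show 1 ≤ K by simp [K])
    exact le_mul_of_one_le_left (hB0 K) this
  | succ k ih =>
    set C := max c (K * B K)
    have hcC : c ≤ C := le_max_left _ _
    have hk : (1 : ℝ) ≤ k := by exact_mod_cast k.pos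
    rw [PNat.add_coe, PNat.one_coe, Nat.cast_add, Nat.cast_one]
    rcases lt_or_ge (k : ℕ) K with hkK | hkK
    · rw [le_div_iff₀ (by positivity)]
      have h1 : e (k + 1) ≤ B K := (hB _).trans (hBmono (by rw [PNat.add_coe]; exact hkK))
      have h2 : (k : ℝ) + 1 ≤ K := by exact_mod_cast hkK
      calc e (k + 1) * (k + 1) ≤ B K * K := by gcongr
        _ ≤ C := by rw [mul_comm]; exact le_max_right _ _
    · have hk2 : (2 : ℝ) ≤ k := by exact_mod_cast (le_max_right n 2).trans hkK
      have hkn : b / (a - 2) ≤ k := hn.trans (by exact_mod_cast (le_max_left n 2).trans hkK)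
      have hb' : b ≤ k * (a - 2) := (div_le_iff₀ (by linarith)).1 hkn
      have hcoef : 1 - a / k + b / (k : ℝ) ^ 2 ≤ 1 - 2 / k := by
        have : b / (k : ℝ) ^ 2 ≤ (a - 2) / k := by
          rw [div_le_div_iff₀ (by positivity) (by positivity)]
          nlinarith
        rw [sub_div] at this
        linarith
      have h2k : 0 ≤ 1 - 2 / (k : ℝ) := by
        rw [sub_nonneg, div_le_one (by positivity)]
        exact hk2
      calc e (k + 1) ≤ (1 - a / k + b / (k : ℝ) ^ 2) * e k + c / (k : ℝ) ^ 2 := hrec k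
        _ ≤ (1 - 2 / k) * e k + c / (k : ℝ) ^ 2 := by
          gcongr
          exact he0 k
        _ ≤ (1 - 2 / k) * (C / k) + C / (k : ℝ) ^ 2 := by gcongr
        _ = C * ((k - 1) / (k : ℝ) ^ 2) := by field_simp; ring
        _ ≤ C * (1 / (k + 1)) := by
          refine mul_le_mul_of_nonneg_left ?_ (hc.trans hcC)
          rw [div_le_div_iff₀ (by positivity) (by positivity)]
          nlinarith
        _ = C / (k + 1) := by ring

/-! ### The resolvent equation of a monotone map -/

section

variable {H : Type*} [NormedAddCommGroup H] [InnerProductSpace ℝ H]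

/-- Error of one implicit step: `r` and `d` are the displacements from `w*` before and after it, `q` is
the gradient at the new point and `g` the gradient at `w*`. The cross term `⟪g, r⟫` carries the
deterministic weight `2 α`, so that it vanishes in expectation even if `g` and `μ` are
correlated. -/
theorem norm_sq_le_of_implicit_step {α μ : ℝ} (hα : 0 ≤ α) (hμ : 0 ≤ μ) {r d q g : H}
    (hstep : d = r - α • q) (hmono : μ * ‖d‖ ^ 2 ≤ inner ℝ (q - g) d) :
    ‖d‖ ^ 2 ≤ (1 - 2 * α * μ + 5 * α ^ 2 * μ ^ 2) * ‖r‖ ^ 2 - 2 * α * inner ℝ g r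
      + 3 * α ^ 2 * ‖g‖ ^ 2 := by
  set t := α * μ with ht
  have ht0 : 0 ≤ t := mul_nonneg hα hμ
  have h1 : (1 + t) * ‖d‖ ^ 2 ≤ ‖r - α • g‖ * ‖d‖ := by
    have e : r - α • g = d + α • (q - g) := by rw [hstep, smul_sub]; abel
    refine le_trans ?_ (real_inner_le_norm (r - α • g) d)
    rw [e, inner_add_left, real_inner_self_eq_norm_sq, real_inner_smul_left]
    nlinarith [mul_le_mul_of_nonneg_left hmono hα]
  have h2 : (1 + t) * ‖d‖ ≤ ‖r - α • g‖ := by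
    rcases (norm_nonneg d).eq_or_lt with h | h
    · rw [← h, mul_zero]; exact norm_nonneg _
    · refine le_of_mul_le_mul_right ?_ h
      linarith
  have h3 : (1 + t) ^ 2 * ‖d‖ ^ 2 ≤ ‖r‖ ^ 2 - 2 * α * inner ℝ g r + α ^ 2 * ‖g‖ ^ 2 := by
    have := pow_le_pow_left₀ (by positivity) h2 2
    rw [norm_sub_sq_real, real_inner_smul_right, norm_smul, real_inner_comm,
      Real.norm_of_nonneg hα] at this
    nlinarith
  -- the squared contraction factor `c` satisfies `1 - 2 t ≤ c ≤ 1 - 2 t + 3 t²`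
  set c := ((1 + t) ^ 2)⁻¹
  have hc0 : 0 ≤ c := by positivity
  have hc : c * (1 + t) ^ 2 = 1 := inv_mul_cancel₀ (by positivity)
  have hc1 : c ≤ 1 := inv_le_one_of_one_le₀ (one_le_pow₀ (by linarith))
  have hc2 : 1 - c ≤ 2 * t := by nlinarith [mul_nonneg hc0 ht0, mul_nonneg hc0 (sq_nonneg t)]
  have hc3 : c ≤ 1 - 2 * t + 3 * t ^ 2 := by
    refine le_of_mul_le_mul_right (a := (1 + t) ^ 2) ?_ (by positivity)
    rw [hc]
    nlinarith [pow_nonneg ht0 3, pow_nonneg ht0 4]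
  have h4 := mul_le_mul_of_nonneg_left h3 hc0
  rw [← mul_assoc, hc, one_mul] at h4
  have h5 : 2 * α * (1 - c) * inner ℝ g r ≤ 2 * t ^ 2 * ‖r‖ ^ 2 + 2 * α ^ 2 * ‖g‖ ^ 2 := by
    calc 2 * α * (1 - c) * inner ℝ g r ≤ 2 * α * (1 - c) * (‖g‖ * ‖r‖) :=
          mul_le_mul_of_nonneg_left (real_inner_le_norm g r)
            (mul_nonneg (by positivity) (by linarith))
      _ ≤ 2 * α * (2 * t) * (‖g‖ * ‖r‖) := by gcongr
      _ ≤ _ := by nlinarith [sq_nonneg (t * ‖r‖ - α * ‖g‖)]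
  have h6 := mul_le_mul_of_nonneg_right hc3 (sq_nonneg ‖r‖)
  have h7 := mul_le_mul_of_nonneg_right hc1 (mul_nonneg (sq_nonneg α) (sq_nonneg ‖g‖))
  have e1 : (1 - 2 * α * μ + 5 * α ^ 2 * μ ^ 2) = 1 - 2 * t + 5 * t ^ 2 := by rw [ht]; ring
  rw [e1]
  nlinarith

/-- The explicit iteration `y ↦ y - γ (y + α G y - x)`, started at `x`, for the resolvent equation
`y + α G y = x`. -/
def resolventIterate (G : H → H) (α γ : ℝ) (x : H) : ℕ → H
  | 0 => x
  | n + 1 => resolventIterate G α γ x n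
      - γ • (resolventIterate G α γ x n + α • G (resolventIterate G α γ x n) - x)

/-- The explicit iteration converges to a given solution `z` of `z + α G z = x`. Since
`‖x - z‖ ≤ α ‖G x‖`, the iterates, which approach `z` monotonically, stay in the ball of radius `R` on
which `G` is Lipschitz. -/
theorem tendsto_resolventIterate {G : H → H} {α K R : ℝ} (hα : 0 ≤ α) (hK : 0 ≤ K) {x z : H}
    (hz : z = x - α • G z) (hmono : ∀ y, 0 ≤ inner ℝ (G y - G z) (y - z))
    (hR : ‖x‖ + 2 * (α * ‖G x‖) ≤ R)
    (hLip : ∀ u v : H, ‖u‖ ≤ R → ‖v‖ ≤ R → ‖G u - G v‖ ≤ K * ‖u - v‖) :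
    Tendsto (resolventIterate G α ((1 + α * K) ^ 2)⁻¹ x) atTop (𝓝 z) := by
  set γ := ((1 + α * K) ^ 2)⁻¹ with hγ
  have hL1 : 1 ≤ (1 + α * K) ^ 2 := one_le_pow₀ (by nlinarith [mul_nonneg hα hK])
  have hγ0 : 0 < γ := by positivity
  have hγ1 : γ ≤ 1 := inv_le_one_of_one_le₀ hL1
  have hγL : γ * (1 + α * K) ^ 2 = 1 := inv_mul_cancel₀ (by positivity)
  have hA : ∀ y, y + α • G y - x = (y - z) + α • (G y - G z) := by
    intro y
    nth_rw 1 [hz]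
    rw [smul_sub]
    abel
  have hA' : ∀ y, ‖y - z‖ ^ 2 ≤ inner ℝ (y + α • G y - x) (y - z) := by
    intro y
    rw [hA, inner_add_left, real_inner_self_eq_norm_sq, real_inner_smul_left]
    nlinarith [mul_nonneg hα (hmono y)]
  have hxz : ‖x - z‖ ≤ α * ‖G x‖ := by
    have h1 := (hA' x).trans (real_inner_le_norm _ _)
    rw [add_sub_cancel_left, norm_smul, Real.norm_of_nonneg hα] at h1
    rcases (norm_nonneg (x - z)).eq_or_lt with h | h
    · rw [← h]; positivity
    · exact le_of_mul_le_mul_right (by linarith) h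
  have hball : ∀ y, ‖y - z‖ ≤ ‖x - z‖ → ‖y‖ ≤ R := by
    intro y hy
    have h1 : ‖y‖ ≤ ‖y - z‖ + ‖z - x‖ + ‖x‖ := by
      calc ‖y‖ = ‖(y - z) + (z - x) + x‖ := by congr 1; abel
        _ ≤ _ := norm_add₃_le
    rw [norm_sub_rev z x] at h1
    linarith
  have hzR : ‖z‖ ≤ R := hball z (by simp)
  have key : ∀ n, ‖resolventIterate G α γ x n - z‖ ^ 2 ≤ (1 - γ) ^ n * ‖x - z‖ ^ 2 := by
    intro n
    induction n with
    | zero => simp [resolventIterate]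
    | succ n ih =>
      set y := resolventIterate G α γ x n with hy
      have hyz : ‖y - z‖ ≤ ‖x - z‖ := by
        refine (sq_le_sq₀ (norm_nonneg _) (norm_nonneg _)).1 (ih.trans ?_)
        exact mul_le_of_le_one_left (sq_nonneg _)
          (pow_le_one₀ (by linarith) (by linarith))
      have hn : ‖y + α • G y - x‖ ≤ (1 + α * K) * ‖y - z‖ := by
        rw [hA]
        refine (norm_add_le _ _).trans ?_
        rw [norm_smul, Real.norm_of_nonneg hα]
        nlinarith [mul_le_mul_of_nonneg_left (hLip y z (hball y hyz) hzR) hα]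
      have hn2 : ‖y + α • G y - x‖ ^ 2 ≤ (1 + α * K) ^ 2 * ‖y - z‖ ^ 2 := by
        rw [← mul_pow]
        exact pow_le_pow_left₀ (norm_nonneg _) hn 2
      have e : resolventIterate G α γ x (n + 1) - z
          = (y - z) - γ • (y + α • G y - x) := by
        rw [resolventIterate, ← hy]; abel
      rw [e, norm_sub_sq_real, real_inner_smul_right, norm_smul, Real.norm_of_nonneg hγ0.le,
        real_inner_comm]
      have h1 := mul_le_mul_of_nonneg_left (hA' y) hγ0.le
      have h2 := mul_le_mul_of_nonneg_left hn2 (sq_nonneg γ)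
      have h3 : γ ^ 2 * ((1 + α * K) ^ 2 * ‖y - z‖ ^ 2) = γ * ‖y - z‖ ^ 2 := by
        linear_combination γ * ‖y - z‖ ^ 2 * hγL
      have h4 := mul_le_mul_of_nonneg_left ih (sub_nonneg.2 hγ1)
      have e2 : (1 - γ) ^ (n + 1) * ‖x - z‖ ^ 2 = (1 - γ) * ((1 - γ) ^ n * ‖x - z‖ ^ 2) := by
        rw [pow_succ]; ring
      rw [e2, mul_pow]
      linarith
  rw [tendsto_iff_norm_sub_tendsto_zero]
  have hlim : Tendsto (fun n : ℕ => (1 - γ) ^ n * ‖x - z‖ ^ 2) atTop (𝓝 0) := by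
    simpa using (tendsto_pow_atTop_nhds_zero_of_lt_one (sub_nonneg.2 hγ1)
      (by linarith)).mul_const (‖x - z‖ ^ 2)
  have hsq := squeeze_zero (fun n => sq_nonneg _) key hlim
  have := (Real.continuous_sqrt.tendsto 0).comp hsq
  simpa [Function.comp_def] using this

end

/-! ### Measurability with respect to a sub-σ-algebra -/

theorem ProbabilityTheory.HasLaw.ae_comp {Ω Ξ : Type*} {mΩ : MeasurableSpace Ω}
    {mΞ : MeasurableSpace Ξ} {P : Measure Ω} {ρ : Measure Ξ} {ξ : Ω → Ξ} (hξ : HasLaw ξ ρ P)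
    {p : Ξ → Prop} (hp : ∀ᵐ s ∂ρ, p s) : ∀ᵐ ω ∂P, p (ξ ω) :=
  ae_of_ae_map hξ.aemeasurable (hξ.map_eq ▸ hp)

theorem ProbabilityTheory.HasLaw.integrable_comp {Ω Ξ E : Type*} {mΩ : MeasurableSpace Ω}
    {mΞ : MeasurableSpace Ξ} {P : Measure Ω} {ρ : Measure Ξ} [NormedAddCommGroup E] {ξ : Ω → Ξ}
    (hξ : HasLaw ξ ρ P) {φ : Ξ → E} (hφ : Integrable φ ρ) : Integrable (fun ω => φ (ξ ω)) P := by
  rw [← hξ.map_eq] at hφ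
  exact hφ.comp_aemeasurable hξ.aemeasurable

/-- A sequence that is a.e. strongly measurable with respect to a sub-σ-algebra has a limit, wherever it
converges, that is measurable for the same sub-σ-algebra. -/
theorem exists_stronglyMeasurable_limit {Ω E : Type*} {m₀ m : MeasurableSpace Ω}
    {P : Measure[m₀] Ω} [NormedAddCommGroup E] [CompleteSpace E] {F : ℕ → Ω → E}
    (hF : ∀ n, AEStronglyMeasurable[m] (F n) P) :
    ∃ g : Ω → E, StronglyMeasurable[m] g ∧
      ∀ᵐ ω ∂P, ∀ l, Tendsto (fun n => F n ω) atTop (𝓝 l) → g ω = l := by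
  refine ⟨fun ω => limUnder atTop fun n => (hF n).mk (F n) ω,
    StronglyMeasurable.limUnder fun n => (hF n).stronglyMeasurable_mk, ?_⟩
  filter_upwards [ae_all_iff.2 fun n => (hF n).ae_eq_mk] with ω hω l hl
  refine Tendsto.limUnder_eq ?_
  simpa only [← hω] using hl

/-- Evaluating a random field at a random point: the field is only assumed to be measurable at each
fixed point and almost surely continuous. -/
theorem aestronglyMeasurable_comp_of_ae_continuous {Ω Ξ X E : Type*} {m₀ m : MeasurableSpace Ω}
    {P : Measure[m₀] Ω} [MeasurableSpace Ξ] {ρ : Measure Ξ}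
    [TopologicalSpace X] [NormedAddCommGroup E] [CompleteSpace E]
    {ξ : Ω → Ξ} (hξm : Measurable[m] ξ) (hξ : HasLaw ξ ρ P) {φ : X → Ξ → E}
    (hφ : ∀ x, AEStronglyMeasurable (φ x) ρ) (hcont : ∀ᵐ s ∂ρ, Continuous fun x => φ x s)
    {Y : Ω → X} (hY : AEStronglyMeasurable[m] Y P) :
    AEStronglyMeasurable[m] (fun ω => φ (Y ω) (ξ ω)) P := by
  have hsm := hY.stronglyMeasurable_mk
  set S := hsm.approx
  have hS : ∀ n, AEStronglyMeasurable[m] (fun ω => φ (S n ω) (ξ ω)) P := by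
    intro n
    refine ⟨fun ω => ∑ v ∈ (S n).range, (S n ⁻¹' {v}).indicator
      (fun ω => (hφ v).mk (φ v) (ξ ω)) ω, ?_, ?_⟩
    · refine Finset.stronglyMeasurable_fun_sum _ fun v _ => ?_
      exact ((hφ v).stronglyMeasurable_mk.comp_measurable hξm).indicator
        ((S n).measurableSet_fiber v)
    · have hae : ∀ᵐ ω ∂P, ∀ v ∈ (S n).range, φ v (ξ ω) = (hφ v).mk (φ v) (ξ ω) :=
        (Finset.eventually_all _).2 fun v _ => hξ.ae_comp (hφ v).ae_eq_mk
      filter_upwards [hae] with ω hω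
      rw [Finset.sum_eq_single (S n ω)]
      · rw [Set.indicator_of_mem (by simp)]
        exact hω _ ((S n).mem_range_self ω)
      · intro v _ hv
        exact Set.indicator_of_notMem (fun h => hv h.symm) _
      · intro h
        exact absurd ((S n).mem_range_self ω) h
  obtain ⟨g, hg, hlim⟩ := exists_stronglyMeasurable_limit hS
  refine ⟨g, hg, ?_⟩
  filter_upwards [hlim, hξ.ae_comp hcont, hY.ae_eq_mk] with ω h1 h2 h3
  refine (h1 _ ?_).symm
  rw [h3]
  exact (h2.tendsto _).comp (hsm.tendsto_approx ω)

/-! ### Consequences of the standing assumptions -/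

namespace SPIAssumption

variable {H : Type u} [NormedAddCommGroup H] [InnerProductSpace ℝ H]
  {Ξ : Type w} [MeasurableSpace Ξ] {ρ : Measure Ξ} {f : H → Ξ → ℝ} {wstar : H}
  {m : ℕ} {μ ν σ : ℝ}

theorem ae_add_gateauxDeriv_le (h : SPIAssumption ρ f wstar m μ ν σ) :
    ∀ᵐ s ∂ρ, ∀ x y : H, f y s + gateauxDeriv (fun z => f z s) y (x - y) ≤ f x s := by
  obtain ⟨M, mubar, -, hM, hmu0, hmuM, -⟩ := h.mconvex
  filter_upwards [hM, hmu0, hmuM] with s h1 h2 h3 x y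
  have := (mul_nonneg h2 (sq_nonneg _)).trans (h3 (x - y))
  linarith [h1 x y]

/-- `∇f(·, ξ)` is strongly monotone with constant `μ̄`: add the `M`-convexity inequality to the one with
the two points exchanged. -/
theorem exists_strongMonotone (h : SPIAssumption ρ f wstar m μ ν σ) :
    ∃ mubar : Ξ → ℝ, (∀ᵐ s ∂ρ, 0 ≤ mubar s) ∧
      (∀ᵐ s ∂ρ, ∀ x y : H, mubar s * ‖x - y‖ ^ 2 ≤
        (gateauxDeriv (fun z => f z s) x - gateauxDeriv (fun z => f z s) y) (x - y)) ∧
      Integrable mubar ρ ∧ ∫ s, mubar s ∂ρ = μ ∧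
      Integrable (fun s => mubar s ^ 2) ρ ∧ ∫ s, mubar s ^ 2 ∂ρ = ν ^ 2 := by
  obtain ⟨M, mubar, -, hM, hmu0, hmuM, hi, he, -, hi2, he2⟩ := h.mconvex
  refine ⟨mubar, hmu0, ?_, hi, he, hi2, he2⟩
  filter_upwards [hM, hmuM] with s h1 h2 x y
  have h3 := h1 x y
  have h4 := h1 y x
  rw [← neg_sub x y, map_neg, map_neg, inner_neg_neg] at h4
  rw [sub_apply]
  linarith [h2 (x - y)]

theorem mu_pos (h : SPIAssumption ρ f wstar m μ ν σ) : 0 < μ := by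
  obtain ⟨M, mubar, -, -, -, -, -, -, hpos, -⟩ := h.mconvex
  exact hpos

/-- On each ball, `∇f(·, ξ)` has a deterministic Lipschitz constant. -/
theorem exists_lipschitz_bound (h : SPIAssumption ρ f wstar m μ ν σ) :
    ∃ K : ℝ → ℝ, (∀ R, 0 ≤ K R) ∧ ∀ R > 0, ∀ᵐ s ∂ρ, ∀ x y : H, ‖x‖ ≤ R → ‖y‖ ≤ R →
      ‖gateauxDeriv (fun z => f z s) x - gateauxDeriv (fun z => f z s) y‖ ≤ K R * ‖x - y‖ := by
  obtain ⟨Lip, hLip, p, -, hp⟩ := h.lipschitz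
  refine ⟨fun R => max (p.eval R) 0, fun R => le_max_right _ _, fun R hR => ?_⟩
  filter_upwards [hLip R hR, hp R hR] with s h1 h2 x y hx hy
  exact (h1 x y hx hy).trans
    (mul_le_mul_of_nonneg_right (h2.trans (le_max_left _ _)) (norm_nonneg _))

theorem ae_continuous_gateauxDeriv (h : SPIAssumption ρ f wstar m μ ν σ) :
    ∀ᵐ s ∂ρ, Continuous fun x => gateauxDeriv (fun z => f z s) x := by
  obtain ⟨K, -, hK⟩ := h.exists_lipschitz_bound
  have hall : ∀ᵐ s ∂ρ, ∀ n : ℕ, ∀ x y : H, ‖x‖ ≤ (n + 1 : ℝ) → ‖y‖ ≤ (n + 1 : ℝ) →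
      ‖gateauxDeriv (fun z => f z s) x - gateauxDeriv (fun z => f z s) y‖
        ≤ K (n + 1) * ‖x - y‖ :=
    ae_all_iff.2 fun n => hK _ (by positivity)
  filter_upwards [hall] with s hs
  refine continuous_iff_continuousAt.2 fun x => ?_
  obtain ⟨n, hn⟩ := exists_nat_gt ‖x‖
  have hev : ∀ᶠ y in 𝓝 x, ‖y‖ ≤ (n + 1 : ℝ) := by
    filter_upwards [(continuous_norm.tendsto x).eventually (gt_mem_nhds hn)] with y hy
    linarith
  rw [ContinuousAt, tendsto_iff_norm_sub_tendsto_zero]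
  refine squeeze_zero' (Eventually.of_forall fun _ => norm_nonneg _)
    (hev.mono fun y hy => hs n y x hy (by linarith)) ?_
  have : Continuous fun y => K (n + 1) * ‖y - x‖ := by fun_prop
  simpa using this.tendsto x

theorem integrable_gateauxDeriv [IsFiniteMeasure ρ] (h : SPIAssumption ρ f wstar m μ ν σ) :
    Integrable (fun s => gateauxDeriv (fun z => f z s) wstar) ρ := by
  refine Integrable.mono' ((integrable_const (1 : ℝ)).add h.integrable_moment)
    (h.aestronglyMeasurable_deriv wstar) (Eventually.of_forall fun s => ?_)
  set a := ‖gateauxDeriv (fun z => f z s) wstar‖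
  have ha : 0 ≤ a := norm_nonneg _
  change a ≤ 1 + a ^ 2 ^ m
  rcases le_total a 1 with h1 | h1
  · linarith [pow_nonneg ha (2 ^ m)]
  · linarith [le_self_pow₀ h1 (show 2 ^ m ≠ 0 by positivity)]

theorem sq_norm_le_one_add_moment (h : SPIAssumption ρ f wstar m μ ν σ) (s : Ξ) :
    ‖gateauxDeriv (fun z => f z s) wstar‖ ^ 2
      ≤ 1 + ‖gateauxDeriv (fun z => f z s) wstar‖ ^ 2 ^ m := by
  set a := ‖gateauxDeriv (fun z => f z s) wstar‖
  have ha : 0 ≤ a := norm_nonneg _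
  rcases le_total a 1 with h1 | h1
  · linarith [pow_nonneg ha (2 ^ m), pow_le_one₀ (n := 2) ha h1]
  · have : 2 ≤ 2 ^ m := le_self_pow₀ (by norm_num) (by have := h.one_le_m; omega)
    linarith [pow_le_pow_right₀ h1 this]

theorem integrable_sq_norm_gateauxDeriv [IsFiniteMeasure ρ]
    (h : SPIAssumption ρ f wstar m μ ν σ) :
    Integrable (fun s => ‖gateauxDeriv (fun z => f z s) wstar‖ ^ 2) ρ := by
  refine Integrable.mono' ((integrable_const (1 : ℝ)).add h.integrable_moment)
    ((h.aestronglyMeasurable_deriv wstar).norm.pow 2) (Eventually.of_forall fun s => ?_)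
  rw [Real.norm_of_nonneg (sq_nonneg _)]
  exact h.sq_norm_le_one_add_moment s

theorem sigma_nonneg (h : SPIAssumption ρ f wstar m μ ν σ) : 0 ≤ σ := by
  rw [← h.moment_eq]
  positivity

theorem integral_sq_norm_gateauxDeriv_le [IsProbabilityMeasure ρ]
    (h : SPIAssumption ρ f wstar m μ ν σ) :
    ∫ s, ‖gateauxDeriv (fun z => f z s) wstar‖ ^ 2 ∂ρ ≤ 1 + σ ^ 2 ^ m := by
  have h1 : ∫ s, ‖gateauxDeriv (fun z => f z s) wstar‖ ^ 2 ^ m ∂ρ = σ ^ 2 ^ m := by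
    have h0 : 0 ≤ ∫ s, ‖gateauxDeriv (fun z => f z s) wstar‖ ^ 2 ^ m ∂ρ :=
      integral_nonneg fun s => by positivity
    rw [← h.moment_eq, ← Real.rpow_natCast, ← Real.rpow_mul h0]
    push_cast
    rw [one_div, inv_mul_cancel₀ (by positivity), Real.rpow_one]
  rw [← h1]
  refine (integral_mono h.integrable_sq_norm_gateauxDeriv
    ((integrable_const (1 : ℝ)).add h.integrable_moment) h.sq_norm_le_one_add_moment).trans_eq ?_
  simp only [Pi.add_apply]
  rw [integral_add (integrable_const _) h.integrable_moment]
  simp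

end SPIAssumption

theorem extExpectation_coe_of_integrable {Ξ : Type*} [MeasurableSpace Ξ] {ρ : Measure Ξ}
    {φ : Ξ → ℝ} (hφ : Integrable φ ρ) :
    extExpectation ρ (fun s => (φ s : EReal)) = ((∫ s, φ s ∂ρ : ℝ) : EReal) := by
  have h1 : ∫⁻ s, ENNReal.ofReal (φ s) ∂ρ ≠ ⊤ := hφ.lintegral_lt_top.ne
  have h2 : ∫⁻ s, ENNReal.ofReal (-φ s) ∂ρ ≠ ⊤ := hφ.neg.lintegral_lt_top.ne
  rw [integral_eq_lintegral_pos_part_sub_lintegral_neg_part hφ, EReal.coe_sub,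
    EReal.coe_ennreal_toReal h1, EReal.coe_ennreal_toReal h2]
  rfl

namespace SPIAssumption

variable {H : Type u} [NormedAddCommGroup H] [InnerProductSpace ℝ H]
  {Ξ : Type w} [MeasurableSpace Ξ] {ρ : Measure Ξ} {f : H → Ξ → ℝ} {wstar : H}
  {m : ℕ} {μ ν σ : ℝ}

/-- `F(w*)` is finite, as `E[inf_x f(x, ξ)] > -∞` and `F` is not identically `∞`. -/
theorem integrable_at_min (h : SPIAssumption ρ f wstar m μ ν σ) : Integrable (f wstar) ρ := by
  have hneg : ∫⁻ s, ENNReal.ofReal (-f wstar s) ∂ρ ≠ ⊤ := by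
    have h1 : ∫⁻ s, (-⨅ x, (f x s : EReal)).toENNReal ∂ρ ≠ ⊤ := by
      intro htop
      have := h.bot_lt_iInf
      rw [extExpectation, htop, EReal.coe_ennreal_top, EReal.sub_top] at this
      exact lt_irrefl _ this
    refine ne_top_of_le_ne_top h1 (lintegral_mono fun s => ?_)
    rw [← EReal.real_coe_toENNReal, EReal.coe_neg]
    exact EReal.toENNReal_le_toENNReal (EReal.neg_le_neg_iff.2 (iInf_le _ wstar))
  have hpos : ∫⁻ s, ENNReal.ofReal (f wstar s) ∂ρ ≠ ⊤ := by
    intro htop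
    obtain ⟨x, hx⟩ := h.objective_lt_top
    have h1 : extExpectation ρ (fun s => (f wstar s : EReal)) < ⊤ := (h.isMin x).trans_lt hx
    have h2 : extExpectation ρ (fun s => (f wstar s : EReal))
        = ((∫⁻ s, ENNReal.ofReal (f wstar s) ∂ρ : ENNReal) : EReal)
          - ((∫⁻ s, ENNReal.ofReal (-f wstar s) ∂ρ : ENNReal) : EReal) := rfl
    rw [h2, htop, ← ENNReal.coe_toNNReal hneg, EReal.coe_ennreal_top] at h1
    exact absurd h1 (by simp)
  refine ⟨(h.aemeasurable wstar).aestronglyMeasurable, ?_⟩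
  rw [hasFiniteIntegral_iff_norm]
  have : ∀ s, ENNReal.ofReal ‖f wstar s‖
      ≤ ENNReal.ofReal (f wstar s) + ENNReal.ofReal (-f wstar s) := by
    intro s
    rcases le_total 0 (f wstar s) with h0 | h0
    · rw [Real.norm_of_nonneg h0]; exact le_self_add
    · rw [Real.norm_of_nonpos h0]; exact le_add_self
  refine (lintegral_mono this).trans_lt ?_
  rw [lintegral_add_left' (h.aemeasurable wstar).ennreal_ofReal]
  exact ENNReal.add_lt_top.2 ⟨hpos.lt_top, hneg.lt_top⟩

/-- First-order optimality. The difference quotient of `f(·, ξ)` at `w*` in direction `v` is squeezed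
between `∇f(w*, ξ) v` and `∇f(w*, ξ) v + K t ‖v‖²` with a deterministic `K`, so the derivative can be
exchanged with the expectation. -/
theorem integral_gateauxDeriv_eq_zero [IsProbabilityMeasure ρ]
    (h : SPIAssumption ρ f wstar m μ ν σ) :
    ∫ s, gateauxDeriv (fun z => f z s) wstar ∂ρ = 0 := by
  obtain ⟨K, -, hK⟩ := h.exists_lipschitz_bound
  have hgi := h.integrable_gateauxDeriv
  have hfi := h.integrable_at_min
  have key : ∀ v : H, 0 ≤ (∫ s, gateauxDeriv (fun z => f z s) wstar ∂ρ) v := by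
    intro v
    set g : Ξ → ℝ := fun s => gateauxDeriv (fun z => f z s) wstar v
    have hg : Integrable g ρ := (ContinuousLinearMap.apply ℝ ℝ v).integrable_comp hgi
    rw [ContinuousLinearMap.integral_apply hgi]
    set R := ‖wstar‖ + ‖v‖ + 1
    have hbound : ∀ t ∈ Set.Ioc (0 : ℝ) 1, 0 ≤ ∫ s, g s ∂ρ + K R * ‖v‖ ^ 2 * t := by
      rintro t ⟨ht0, ht1⟩
      have hlow : ∀ᵐ s ∂ρ, f wstar s + t * g s ≤ f (wstar + t • v) s := by
        filter_upwards [h.ae_add_gateauxDeriv_le] with s hs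
        have := hs (wstar + t • v) wstar
        rwa [add_sub_cancel_left, map_smul, smul_eq_mul] at this
      have hup : ∀ᵐ s ∂ρ, f (wstar + t • v) s
          ≤ f wstar s + t * g s + K R * ‖v‖ ^ 2 * t ^ 2 := by
        filter_upwards [h.ae_add_gateauxDeriv_le, hK R (by positivity)] with s hs hL
        have h1 := hs wstar (wstar + t • v)
        rw [sub_add_cancel_left, map_neg, map_smul, smul_eq_mul] at h1
        have hnv : ‖t • v‖ = t * ‖v‖ := by rw [norm_smul, Real.norm_of_nonneg ht0.le]
        have h2 := hL (wstar + t • v) wstar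
          (by
            refine (norm_add_le _ _).trans ?_
            rw [hnv]
            nlinarith [norm_nonneg v])
          (by simp only [R]; linarith [norm_nonneg v])
        rw [add_sub_cancel_left, hnv] at h2
        have h3 := (le_abs_self _).trans (((gateauxDeriv (fun z => f z s) (wstar + t • v)
          - gateauxDeriv (fun z => f z s) wstar).le_opNorm v).trans
            (mul_le_mul_of_nonneg_right h2 (norm_nonneg v)))
        rw [sub_apply] at h3
        have h4 := mul_le_mul_of_nonneg_left h3 ht0.le
        simp only [g]
        nlinarith
      have hi1 : Integrable (fun s => f wstar s + t * g s) ρ := hfi.add (hg.const_mul t)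
      have hi2 : Integrable (fun s => f wstar s + t * g s + K R * ‖v‖ ^ 2 * t ^ 2) ρ :=
        hi1.add (integrable_const _)
      have hfv : Integrable (f (wstar + t • v)) ρ :=
        integrable_of_le_of_le (h.aemeasurable _).aestronglyMeasurable hlow hup hi1 hi2
      have hmin : ∫ s, f wstar s ∂ρ ≤ ∫ s, f (wstar + t • v) s ∂ρ := by
        have := h.isMin (wstar + t • v)
        rw [objective, objective, extExpectation_coe_of_integrable hfi,
          extExpectation_coe_of_integrable hfv] at this
        exact_mod_cast this
      have hle := hmin.trans (integral_mono_ae hfv hi2 hup)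
      rw [integral_add hi1 (integrable_const _), integral_add hfi (hg.const_mul t),
        integral_const_mul] at hle
      simp only [integral_const, probReal_univ, one_smul] at hle
      refine le_of_mul_le_mul_left ?_ ht0
      linarith
    have hcont : Tendsto (fun t : ℝ => ∫ s, g s ∂ρ + K R * ‖v‖ ^ 2 * t) (𝓝[>] 0)
        (𝓝 (∫ s, g s ∂ρ)) := by
      have : Continuous fun t : ℝ => ∫ s, g s ∂ρ + K R * ‖v‖ ^ 2 * t := by fun_prop
      simpa using (this.tendsto 0).mono_left nhdsWithin_le_nhds
    exact ge_of_tendsto hcont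
      (eventually_of_mem (Ioc_mem_nhdsGT one_pos) hbound)
  ext v
  have h1 := key (-v)
  rw [map_neg] at h1
  exact le_antisymm (by simpa using h1) (key v)

end SPIAssumption

/-! ### The implicit step: measurability and expected error -/

namespace SPIAssumption

variable {H : Type u} [NormedAddCommGroup H] [InnerProductSpace ℝ H] [CompleteSpace H]
  {Ξ : Type w} [MeasurableSpace Ξ] {ρ : Measure Ξ} {f : H → Ξ → ℝ} {wstar : H}
  {m : ℕ} {μ ν σ : ℝ} {Ω : Type v}

/-- A solution of the implicit step is measurable for any σ-algebra that makes its data `X` and `ξ`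
measurable. -/
theorem aestronglyMeasurable_implicit_step (h : SPIAssumption ρ f wstar m μ ν σ)
    {m₀ 𝓕 : MeasurableSpace Ω} {P : Measure[m₀] Ω} {ξ : Ω → Ξ} (hξm : Measurable[𝓕] ξ)
    (hξ : HasLaw ξ ρ P) {α : ℝ} (hα : 0 ≤ α) {X Z : Ω → H} (hX : AEStronglyMeasurable[𝓕] X P)
    (hZ : ∀ᵐ ω ∂P, Z ω = X ω - α •
      (InnerProductSpace.toDual ℝ H).symm (gateauxDeriv (fun y => f y (ξ ω)) (Z ω))) :
    AEStronglyMeasurable[𝓕] Z P := by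
  set G : H → Ξ → H := fun x s =>
    (InnerProductSpace.toDual ℝ H).symm (gateauxDeriv (fun y => f y s) x) with hG
  have hGm : ∀ x, AEStronglyMeasurable (G x) ρ := fun x =>
    (InnerProductSpace.toDual ℝ H).symm.continuous.comp_aestronglyMeasurable
      (h.aestronglyMeasurable_deriv x)
  have hGc : ∀ᵐ s ∂ρ, Continuous fun x => G x s := by
    filter_upwards [h.ae_continuous_gateauxDeriv] with s hs
    exact (InnerProductSpace.toDual ℝ H).symm.continuous.comp hs
  obtain ⟨K, hK0, hK⟩ := h.exists_lipschitz_bound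
  -- the radius needed at `ω` depends on `ω`: run the iteration for every radius `N + 1`, take the
  -- limits `Y N`, which are junk where `N` is too small, and then let `N → ∞`
  set γ : ℕ → ℝ := fun N => ((1 + α * K (N + 1)) ^ 2)⁻¹
  have hiter : ∀ N n, AEStronglyMeasurable[𝓕]
      (fun ω => resolventIterate (fun x => G x (ξ ω)) α (γ N) (X ω) n) P := by
    intro N n
    induction n with
    | zero => exact hX
    | succ n ih =>
      have hGi := aestronglyMeasurable_comp_of_ae_continuous hξm hξ hGm hGc ih
      exact ih.sub (((ih.add (hGi.const_smul α)).sub hX).const_smul (γ N))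
  choose Y hYm hY using fun N => exists_stronglyMeasurable_limit (hiter N)
  obtain ⟨Z', hZ'm, hZ'⟩ :=
    exists_stronglyMeasurable_limit fun N => (hYm N).aestronglyMeasurable (μ := P)
  refine ⟨Z', hZ'm, ?_⟩
  obtain ⟨mubar, hmu0, hmono, -⟩ := h.exists_strongMonotone
  have hLip : ∀ᵐ s ∂ρ, ∀ N : ℕ, ∀ x y : H, ‖x‖ ≤ (N + 1 : ℝ) → ‖y‖ ≤ (N + 1 : ℝ) →
      ‖gateauxDeriv (fun z => f z s) x - gateauxDeriv (fun z => f z s) y‖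
        ≤ K (N + 1) * ‖x - y‖ :=
    ae_all_iff.2 fun N => hK _ (by positivity)
  filter_upwards [hZ, ae_all_iff.2 hY, hZ', hξ.ae_comp hmu0, hξ.ae_comp hmono, hξ.ae_comp hLip]
    with ω h1 h2 h3 h4 h5 h6
  refine (h3 _ ?_).symm
  -- `Y N ω` is the solution itself for all `N ≥ N₀`
  obtain ⟨N₀, hN₀⟩ := exists_nat_ge (‖X ω‖ + 2 * (α * ‖G (X ω) (ξ ω)‖))
  refine tendsto_const_nhds.congr' ((eventually_ge_atTop N₀).mono fun N hN => (h2 N _ ?_).symm)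
  have hNN : (N₀ : ℝ) ≤ N := by exact_mod_cast hN
  refine tendsto_resolventIterate (R := N + 1) hα (hK0 _) h1 (fun y => ?_) (by linarith)
    fun x y hx hy => ?_
  · rw [hG, ← map_sub, InnerProductSpace.toDual_symm_apply]
    exact (mul_nonneg h4 (sq_nonneg _)).trans (h5 y (Z ω))
  · rw [hG, ← map_sub, LinearIsometryEquiv.norm_map]
    exact h6 N x y hx hy

/-- The expected squared error after an implicit step whose sample `ξ` is independent of the
σ-algebra `𝓕` of the current iterate. -/
theorem integrable_and_integral_implicit_step_le [IsProbabilityMeasure ρ]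
    (h : SPIAssumption ρ f wstar m μ ν σ)
    {m₀ : MeasurableSpace Ω} {𝓕 : MeasurableSpace Ω} {P : Measure[m₀] Ω} [IsProbabilityMeasure P]
    (h𝓕 : 𝓕 ≤ m₀) {ξ : Ω → Ξ} (hξ : HasLaw ξ ρ P)
    (hind : Indep 𝓕 (MeasurableSpace.comap ξ inferInstance) P) {α : ℝ} (hα : 0 ≤ α) {X Z : Ω → H}
    (hX : AEStronglyMeasurable[𝓕] X P) (hZm : AEStronglyMeasurable[m₀] Z P)
    (hXi : Integrable (fun ω => ‖X ω - wstar‖ ^ 2) P)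
    (hZ : ∀ᵐ ω ∂P, Z ω = X ω - α •
      (InnerProductSpace.toDual ℝ H).symm (gateauxDeriv (fun y => f y (ξ ω)) (Z ω))) :
    Integrable (fun ω => ‖Z ω - wstar‖ ^ 2) P ∧
      ∫ ω, ‖Z ω - wstar‖ ^ 2 ∂P ≤
        (1 - 2 * α * μ + 5 * α ^ 2 * ν ^ 2) * ∫ ω, ‖X ω - wstar‖ ^ 2 ∂P
          + 3 * α ^ 2 * (1 + σ ^ 2 ^ m) := by
  have hmapξ := hξ.map_eq
  obtain ⟨mubar, hmu0, hmono, hmui, hmue, hmui2, hmue2⟩ := h.exists_strongMonotone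
  borelize H
  borelize (StrongDual ℝ H)
  set g : Ξ → StrongDual ℝ H := fun s => gateauxDeriv (fun z => f z s) wstar with hg
  have hgi : Integrable g ρ := h.integrable_gateauxDeriv
  have hgi2 : Integrable (fun s => ‖g s‖ ^ 2) ρ := h.integrable_sq_norm_gateauxDeriv
  set c : Ξ → ℝ := fun s => 1 - 2 * α * mubar s + 5 * α ^ 2 * mubar s ^ 2 with hc
  have hci0 : Integrable (fun s => 1 - 2 * α * mubar s) ρ :=
    (integrable_const _).sub (hmui.const_mul _)
  have hci : Integrable c ρ := hci0.add (hmui2.const_mul _)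
  have hce : ∫ s, c s ∂ρ = 1 - 2 * α * μ + 5 * α ^ 2 * ν ^ 2 := by
    rw [hc, integral_add hci0 (hmui2.const_mul _),
      integral_sub (integrable_const _) (hmui.const_mul _), integral_const_mul,
      integral_const_mul, hmue, hmue2]
    simp
  -- the displacement depends on the past only, hence is independent of `ξ`
  set R : Ω → H := fun ω => X ω - wstar with hR
  have hR𝓕 : AEStronglyMeasurable[𝓕] R P := hX.sub aestronglyMeasurable_const
  have hRm : AEStronglyMeasurable[m₀] R P := hR𝓕.mono h𝓕
  have hRξ : IndepFun R ξ P := by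
    refine IndepFun.congr (f := hR𝓕.mk R) (g := ξ) ?_ hR𝓕.ae_eq_mk.symm EventuallyEq.rfl
    rw [IndepFun_iff_Indep]
    exact indep_of_indep_of_le_left hind hR𝓕.stronglyMeasurable_mk.measurable.comap_le
  have hRi : Integrable R P := by
    refine (((memLp_two_iff_integrable_sq_norm hRm).2 hXi).integrable (by norm_num))
  have hcR : IndepFun (fun ω => ‖R ω‖ ^ 2) (fun ω => c (ξ ω)) P :=
    hRξ.comp₀ hRm.aemeasurable hξ.aemeasurable (φ := fun x => ‖x‖ ^ 2) (ψ := c)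
      (by fun_prop) (hmapξ ▸ hci.aestronglyMeasurable.aemeasurable)
  have hgR : IndepFun R (fun ω => g (ξ ω)) P :=
    hRξ.comp₀ hRm.aemeasurable hξ.aemeasurable (φ := fun x => x) (ψ := g)
      (by fun_prop) (hmapξ ▸ hgi.aestronglyMeasurable.aemeasurable)
  have hcξ : Integrable (fun ω => c (ξ ω)) P := hξ.integrable_comp hci
  have hgξ : Integrable (fun ω => g (ξ ω)) P := hξ.integrable_comp hgi
  have hg2ξ : Integrable (fun ω => ‖g (ξ ω)‖ ^ 2) P := hξ.integrable_comp hgi2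
  have hi1 : Integrable (fun ω => ‖R ω‖ ^ 2 * c (ξ ω)) P := hcR.integrable_mul hXi hcξ
  have hi2 : Integrable (fun ω => g (ξ ω) (R ω)) P :=
    hgR.integrable_bilin hRi hgξ (ContinuousLinearMap.apply ℝ ℝ)
  have he1 : ∫ ω, ‖R ω‖ ^ 2 * c (ξ ω) ∂P
      = (∫ ω, ‖R ω‖ ^ 2 ∂P) * (1 - 2 * α * μ + 5 * α ^ 2 * ν ^ 2) := by
    rw [hcR.integral_fun_mul_eq_mul_integral hXi.aestronglyMeasurable hcξ.aestronglyMeasurable,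
      ← hce]
    congr 1
    exact hξ.integral_comp hci.aestronglyMeasurable
  have he2 : ∫ ω, g (ξ ω) (R ω) ∂P = 0 := by
    have h1 : ∫ ω, g (ξ ω) ∂P = 0 :=
      (hξ.integral_comp hgi.aestronglyMeasurable).trans h.integral_gateauxDeriv_eq_zero
    have h2 := hgR.integral_bilin hRi hgξ (ContinuousLinearMap.apply ℝ ℝ)
    rw [h1, map_zero] at h2
    exact h2
  have he3 : ∫ ω, ‖g (ξ ω)‖ ^ 2 ∂P ≤ 1 + σ ^ 2 ^ m :=
    (hξ.integral_comp hgi2.aestronglyMeasurable).trans_le h.integral_sq_norm_gateauxDeriv_le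
  have hle : ∀ᵐ ω ∂P, ‖Z ω - wstar‖ ^ 2
      ≤ ‖R ω‖ ^ 2 * c (ξ ω) - 2 * α * g (ξ ω) (R ω) + 3 * α ^ 2 * ‖g (ξ ω)‖ ^ 2 := by
    filter_upwards [hZ, hξ.ae_comp hmu0, hξ.ae_comp hmono] with ω h1 h2 h3
    have := norm_sq_le_of_implicit_step (r := R ω) (d := Z ω - wstar)
      (q := (InnerProductSpace.toDual ℝ H).symm (gateauxDeriv (fun y => f y (ξ ω)) (Z ω)))
      (g := (InnerProductSpace.toDual ℝ H).symm (g (ξ ω))) hα h2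
      (by
        simp only [hR]
        nth_rw 1 [h1]
        abel)
      (by
        rw [← map_sub, InnerProductSpace.toDual_symm_apply]
        exact h3 (Z ω) wstar)
    rw [InnerProductSpace.toDual_symm_apply, LinearIsometryEquiv.norm_map] at this
    refine this.trans_eq ?_
    simp only [hc]
    ring
  have hi12 : Integrable (fun ω => ‖R ω‖ ^ 2 * c (ξ ω) - 2 * α * g (ξ ω) (R ω)) P :=
    hi1.sub (hi2.const_mul _)
  have hi3 : Integrable (fun ω => ‖R ω‖ ^ 2 * c (ξ ω) - 2 * α * g (ξ ω) (R ω)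
      + 3 * α ^ 2 * ‖g (ξ ω)‖ ^ 2) P := hi12.add (hg2ξ.const_mul _)
  have hZi : Integrable (fun ω => ‖Z ω - wstar‖ ^ 2) P := by
    refine hi3.mono' ((hZm.sub aestronglyMeasurable_const).norm.pow 2) ?_
    filter_upwards [hle] with ω hω
    rw [Real.norm_of_nonneg (sq_nonneg _)]
    exact hω
  refine ⟨hZi, (integral_mono_ae hZi hi3 hle).trans ?_⟩
  rw [integral_add hi12 (hg2ξ.const_mul _),
    integral_sub hi1 (hi2.const_mul _), integral_const_mul, integral_const_mul, he1, he2]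
  have := mul_le_mul_of_nonneg_left he3 (show 0 ≤ 3 * α ^ 2 by positivity)
  linarith

end SPIAssumption

/-! ### The convergence rate -/

theorem theorem2p1 :
    ∃ C : ℝ → ℝ → ℝ → ℝ → ℝ → ℕ → ℝ,
      ∀ (H : Type u) [NormedAddCommGroup H] [InnerProductSpace ℝ H] [CompleteSpace H]
        (Ω : Type v) [MeasurableSpace Ω] (P : Measure Ω) [IsProbabilityMeasure P]
        (Ξ : Type w) [MeasurableSpace Ξ] (ρ : Measure Ξ) [IsProbabilityMeasure ρ]
        (f : H → Ξ → ℝ) (wstar : H) (m : ℕ) (μ ν σ : ℝ)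
        (ξ : ℕ+ → Ω → Ξ) (η : ℝ) (w₁ : H) (W : ℕ+ → Ω → H),
        SPIAssumption ρ f wstar m μ ν σ →
        (∀ k, HasLaw (ξ k) ρ P) →
        iIndepFun ξ P →
        1 / μ < η →
        IsSPI P f ξ (fun k => η / (k : ℝ)) w₁ W →
        ∀ k : ℕ+,
          AEStronglyMeasurable (W k) P ∧
          Integrable (fun ω => ‖W k ω - wstar‖ ^ 2) P ∧
          ∫ ω, ‖W k ω - wstar‖ ^ 2 ∂P ≤ C ‖w₁ - wstar‖ μ ν σ η m / (k : ℝ) := by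
  -- `1 + σ ^ 2 ^ m` bounds the second moment of `∇f(w*, ξ)`
  have hC : ∀ (D μ ν σ η : ℝ) (m : ℕ), ∃ C : ℝ, 0 < μ → 0 ≤ σ → 1 / μ < η →
      ∀ e : ℕ+ → ℝ, (∀ k, 0 ≤ e k) → e 1 ≤ D ^ 2 →
      (∀ k : ℕ+, e (k + 1) ≤ (1 - 2 * η * μ / k + 5 * η ^ 2 * ν ^ 2 / (k : ℝ) ^ 2) * e k
        + 3 * η ^ 2 * (1 + σ ^ 2 ^ m) / (k : ℝ) ^ 2) →
      ∀ k : ℕ+, e k ≤ C / k := by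
    intro D μ ν σ η m
    by_cases hh : 0 < μ ∧ 0 ≤ σ ∧ 1 / μ < η
    · obtain ⟨hμ, hσ, hη⟩ := hh
      rw [div_lt_iff₀ hμ] at hη
      obtain ⟨C, hC⟩ := exists_le_div_of_recursion (a := 2 * η * μ) (b := 5 * η ^ 2 * ν ^ 2)
        (c := 3 * η ^ 2 * (1 + σ ^ 2 ^ m)) (D := D ^ 2) (by linarith) (by positivity)
        (by positivity) (by positivity)
      exact ⟨C, fun _ _ _ => hC⟩
    · exact ⟨0, fun h1 h2 h3 => absurd ⟨h1, h2, h3⟩ hh⟩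
  choose C hC using hC
  refine ⟨C, ?_⟩
  intro H _ _ _ Ω m₀ P _ Ξ _ ρ _ f wstar m μ ν σ ξ η w₁ W h hlaw hind hη hW
  have hη0 : 0 < η := (one_div_pos.2 h.mu_pos).trans hη
  have hα : ∀ k : ℕ+, 0 ≤ η / (k : ℝ) := fun k => by positivity
  -- the samples are only a.e. measurable: pass to measurable versions `ζ k`, which generate
  -- the σ-algebras `𝓕 k` of the past
  set ζ : ℕ+ → Ω → Ξ := fun k => (hlaw k).aemeasurable.mk (ξ k)
  have hζm : ∀ k, Measurable (ζ k) := fun k => (hlaw k).aemeasurable.measurable_mk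
  have hζ : ∀ k, ξ k =ᵐ[P] ζ k := fun k => (hlaw k).aemeasurable.ae_eq_mk
  have hζlaw : ∀ k, HasLaw (ζ k) ρ P := fun k => (hlaw k).congr (hζ k).symm
  have hζind : iIndep (fun k => MeasurableSpace.comap (ζ k) inferInstance) P :=
    (iIndepFun_iff_iIndep _ _ _).1 (hind.congr hζ)
  have hstep : ∀ k : ℕ+, ∀ᵐ ω ∂P, W (k + 1) ω = W k ω - (η / (k : ℝ)) •
      (InnerProductSpace.toDual ℝ H).symm
        (gateauxDeriv (fun y => f y (ζ k ω)) (W (k + 1) ω)) := by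
    intro k
    filter_upwards [hW.step k, hζ k] with ω h1 h2
    rwa [h2] at h1
  set 𝓕 : ℕ+ → MeasurableSpace Ω := fun k =>
    ⨆ j ∈ Set.Iio k, MeasurableSpace.comap (ζ j) inferInstance
  have h𝓕 : ∀ k, 𝓕 k ≤ m₀ := fun k => iSup₂_le fun j _ => (hζm j).comap_le
  have h𝓕mono : ∀ k, 𝓕 k ≤ 𝓕 (k + 1) := fun k =>
    biSup_mono fun j (hj : j < k) => hj.trans (PNat.lt_add_right k 1)
  have hζ𝓕 : ∀ k, Measurable[𝓕 (k + 1)] (ζ k) := fun k =>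
    Measurable.of_comap_le (le_iSup₂_of_le k (PNat.lt_add_right k 1) le_rfl)
  have h𝓕ind : ∀ k, Indep (𝓕 k) (MeasurableSpace.comap (ζ k) inferInstance) P := by
    intro k
    have := indep_iSup_of_disjoint (fun j => (hζm j).comap_le) hζind
      (S := Set.Iio k) (T := {k}) (by simp)
    simpa [𝓕] using this
  have hWm : ∀ k, AEStronglyMeasurable[𝓕 k] (W k) P := by
    intro k
    induction k using PNat.recOn with
    | one => exact aestronglyMeasurable_const.congr (hW.init.mono fun ω h1 => h1.symm)
    | succ k ih =>
      exact h.aestronglyMeasurable_implicit_step (hζ𝓕 k) (hζlaw k) (hα k)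
        (ih.mono (h𝓕mono k)) (hstep k)
  have hWm₀ : ∀ k, AEStronglyMeasurable (W k) P := fun k => (hWm k).mono (h𝓕 k)
  have hone : (fun ω => ‖W 1 ω - wstar‖ ^ 2) =ᵐ[P] fun _ => ‖w₁ - wstar‖ ^ 2 := by
    filter_upwards [hW.init] with ω h1
    rw [h1]
  have hint : ∀ k, Integrable (fun ω => ‖W k ω - wstar‖ ^ 2) P := by
    intro k
    induction k using PNat.recOn with
    | one => exact (integrable_const _).congr hone.symm
    | succ k ih =>
      exact (h.integrable_and_integral_implicit_step_le (h𝓕 k) (hζlaw k) (h𝓕ind k) (hα k)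
        (hWm k) (hWm₀ (k + 1)) ih (hstep k)).1
  intro k
  refine ⟨hWm₀ k, hint k, hC _ _ _ _ _ _ h.mu_pos h.sigma_nonneg hη
    (fun k => ∫ ω, ‖W k ω - wstar‖ ^ 2 ∂P) (fun k => integral_nonneg fun ω => sq_nonneg _) ?_
    (fun k => ?_) k⟩
  · rw [integral_congr_ae hone]
    simp
  · refine (h.integrable_and_integral_implicit_step_le (h𝓕 k) (hζlaw k) (h𝓕ind k) (hα k)
        (hWm k) (hWm₀ (k + 1)) (hint k) (hstep k)).2.trans_eq ?_
    ring
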